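/- Let $\kappa$ be a regular cardinal and let $\mathcal A$ be a $\kappa$-accessible category; let $\mathcal A_{<\kappa}\subset\mathcal A$ be the full subcategory of $\kappa$-presentable objects. A morphism $m\colon C\to D$ in $\mathcal A$ is a *$\kappa$-pure monomorphism* if for every morphism $t\colon S\to T$ in $\mathcal A_{<\kappa}$ and all morphisms $c\colon S\to C$, $d\colon T\to D$ in $\mathcal A$ with $m\circ c=d\circ t$ there is a morphism $e\colon T\to C$ with $e\circ t=c$. A category has *very weak cokernel pairs* if for all morphisms $f\colon A\to B$ and $c_1,c_2\colon B\rightrightarrows C$ with $c_1\circ f=c_2\circ f$ there exist an object $K$ and morphisms $k_1,k_2\colon B\rightrightarrows K$ such that $k_1\circ f=k_2\circ f$, there is a morphism $l\colon K\to C$ with $l\circ k_1=c_1$ and $l\circ k_2=c_2$, and $k_1$ is a split monomorphism. Assume that $\mathcal A$ has very weak cokernel pairs (for example, this holds if $\mathcal A$ has finite products), and that pushouts of split monomorphisms (along arbitrary morphisms) exist in the category $\mathcal A_{<\kappa}$. Then all pushouts of $\kappa$-pure monomorphisms exist in $\mathcal A$, and all such pushouts are $\kappa$-pure monomorphisms: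 for every $\kappa$-pure monomorphism $m\colon C\to D$ and every morphism $f\colon C\to C'$ in $\mathcal A$, the pushout $D'$ of $m$ and $f$ exists in $\mathcal A$, and for any such pushout the canonical morphism $m'\colon C'\to D'$ is a $\kappa$-pure monomorphism. -/

import Mathlib

open CategoryTheory CategoryTheory.Limits

universe w v u

namespace PureMono

/-- The pair `k₁, k₂ : B ⟶ K` is a very weak cokernel pair of `f : A ⟶ B` with respect to
the pair `c₁, c₂ : B ⟶ C` (which is meant to satisfy `f ≫ c₁ = f ≫ c₂`). -/
structure IsVeryWeakCokernelPair {C : Type u} [Category.{v} C] {A B X K : C}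
    (f : A ⟶ B) (c₁ c₂ : B ⟶ X) (k₁ k₂ : B ⟶ K) : Prop where
  comp_eq : f ≫ k₁ = f ≫ k₂
  exists_fac : ∃ l : K ⟶ X, k₁ ≫ l = c₁ ∧ k₂ ≫ l = c₂
  isSplitMono : IsSplitMono k₁

/-- A category has very weak cokernel pairs if every morphism `f : A ⟶ B` has a very weak
cokernel pair with respect to every pair `c₁, c₂ : B ⟶ X` with `f ≫ c₁ = f ≫ c₂`. -/
def HasVeryWeakCokernelPairs (C : Type u) [Category.{v} C] : Prop :=
  ∀ ⦃A B X : C⦄ (f : A ⟶ B) (c₁ c₂ : B ⟶ X), f ≫ c₁ = f ≫ c₂ →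
    ∃ (K : C) (k₁ k₂ : B ⟶ K), IsVeryWeakCokernelPair f c₁ c₂ k₁ k₂

/-- Every span with one leg a split monomorphism (and the other leg arbitrary) has a pushout. -/
def HasPushoutsOfSplitMonos (C : Type u) [Category.{v} C] : Prop :=
  ∀ ⦃X Y Z : C⦄ (i : X ⟶ Y) (f : X ⟶ Z), IsSplitMono i → HasPushout i f

/-- The full subcategory `A_{<κ}` of `κ`-presentable objects. -/
abbrev Presentables (C : Type u) [Category.{v} C] (κ : Cardinal.{w}) [Fact κ.IsRegular] :
    Type u :=
  (isCardinalPresentable C κ).FullSubcategory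

/-- `m : X ⟶ Y` is a `κ`-pure monomorphism: for every commutative square from a morphism
`t : S ⟶ T` of `κ`-presentable objects to `m`, the map `S ⟶ X` factors through `t`. -/
def IsPureMono {C : Type u} [Category.{v} C] (κ : Cardinal.{w}) [Fact κ.IsRegular]
    {X Y : C} (m : X ⟶ Y) : Prop :=
  ∀ ⦃S T : C⦄, IsCardinalPresentable S κ → IsCardinalPresentable T κ →
    ∀ (t : S ⟶ T) (c : S ⟶ X) (d : T ⟶ Y), c ≫ m = t ≫ d → ∃ e : T ⟶ X, t ≫ e = c

end PureMono

/-! The span `m`, `f` is a `κ`-filtered colimit of spans of `κ`-presentable objects over it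
(`SpanOver`), since comma categories of this kind are `κ`-filtered and project finally onto the
presentables over each object. Purity together with very weak cokernel pairs makes the spans whose
first leg is a split monomorphism cofinal (`SpanOver.exists_isSplitSpan`). Those spans have pushouts
among the presentables, which remain pushouts in `A` (`isPushout_map_ι`). Their colimit is the
required pushout, and its leg out of `Z` is a `κ`-filtered colimit of split monomorphisms, hence
`κ`-pure. -/

namespace PureMono

/-! ### Filteredness and smallness of comma categories. -/

section Comma

variable {J : Type*} [Category J] {T : Type*} [Category T]

/-- The comma category `Comma L (𝟭 T)` is `κ`-filtered if both categories are. -/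
lemma isCardinalFiltered_comma_id (κ : Cardinal.{w}) [Fact κ.IsRegular]
    [IsCardinalFiltered J κ] [IsCardinalFiltered T κ] (L : J ⥤ T) :
    IsCardinalFiltered (Comma L (𝟭 T)) κ := by
  have := isFiltered_of_isCardinalFiltered T κ
  rw [isCardinalFiltered_iff]
  refine ⟨fun ι j hι ↦ ?_, fun ι j k f hι ↦ ?_⟩
  · let p (i : ι) := IsCardinalFiltered.toMax (fun i ↦ (j i).left) hι i
    let q (i : ι) := IsCardinalFiltered.toMax (fun i ↦ (j i).right) hι i
    let a := IsCardinalFiltered.max (fun i ↦ (j i).left) hι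
    let b := IsCardinalFiltered.max (fun i ↦ (j i).right) hι
    -- One `u` makes the squares for all `i` commute at once.
    obtain ⟨l, u, hu⟩ := IsCardinalFiltered.multicoequalizer (κ := κ)
      (fun i ↦ L.map (p i) ≫ IsFiltered.leftToMax (L.obj a) b)
      (fun i ↦ (j i).hom ≫ q i ≫ IsFiltered.rightToMax (L.obj a) b) hι
    exact ⟨⟨a, l, IsFiltered.leftToMax (L.obj a) b ≫ u⟩, fun i ↦
      ⟨{ left := p i
         right := q i ≫ IsFiltered.rightToMax (L.obj a) b ≫ u
         w := by simpa using hu i }⟩⟩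
  · let α := IsCardinalFiltered.coeqHom (fun i ↦ (f i).left) hι
    let α' := IsCardinalFiltered.toCoeq (fun i ↦ (f i).left) hι
    let β := IsCardinalFiltered.coeqHom (fun i ↦ (f i).right) hι
    let β' := IsCardinalFiltered.toCoeq (fun i ↦ (f i).right) hι
    obtain ⟨b, s, r, h⟩ := IsFiltered.span (k.hom ≫ β) (L.map α)
    -- For nonempty `ι` the square at `j` follows from the one at `k`; this coequalizer also covers
    -- empty `ι`.
    obtain ⟨l, c, hc⟩ : ∃ (l : T) (c : b ⟶ l), (L.map α' ≫ r) ≫ c = (j.hom ≫ β' ≫ s) ≫ c :=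
      ⟨_, _, IsFiltered.coeq_condition _ _⟩
    refine ⟨⟨_, _, r ≫ c⟩,
      { left := α, right := β ≫ s ≫ c, w := ?_ },
      { left := α', right := β' ≫ s ≫ c, w := ?_ }, fun i ↦ ?_⟩
    · simpa using (congr($h ≫ c)).symm
    · simpa using hc
    · ext
      · exact IsCardinalFiltered.coeq_condition (fun i ↦ (f i).left) hι i
      · exact IsCardinalFiltered.coeq_condition_assoc (fun i ↦ (f i).right) hι i (s ≫ c)

lemma isCardinalFiltered_fullSubcategory (κ : Cardinal.{w}) [Fact κ.IsRegular]
    [IsCardinalFiltered J κ] (P : ObjectProperty J)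
    (hP : ∀ j, ∃ k, P k ∧ Nonempty (j ⟶ k)) : IsCardinalFiltered P.FullSubcategory κ where
  nonempty_cocone F hK := by
    let c := IsCardinalFiltered.cocone (F ⋙ P.ι) hK
    obtain ⟨k, hk, ⟨g⟩⟩ := hP c.pt
    exact ⟨{
      pt := ⟨k, hk⟩
      ι := {
        app i := P.homMk (c.ι.app i ≫ g)
        naturality i i' φ := by
          ext
          simpa using c.w_assoc φ g } }⟩

lemma essentiallySmall_prod [EssentiallySmall.{w} J] [EssentiallySmall.{w} T] :
    EssentiallySmall.{w} (J × T) :=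
  EssentiallySmall.mk' ((equivSmallModel.{w} J).prod (equivSmallModel.{w} T))

lemma essentiallySmall_comma {J' : Type*} [Category J'] [EssentiallySmall.{w} J]
    [EssentiallySmall.{w} J'] [LocallySmall.{w} T] (L : J ⥤ T) (R : J' ⥤ T) :
    EssentiallySmall.{w} (Comma L R) := by
  let P : ObjectProperty (Comma L R) := ObjectProperty.comma L R ⊤ ⊤
  have : EssentiallySmall.{w} P.FullSubcategory := inferInstance
  let F : Comma L R ⥤ P.FullSubcategory := P.lift (𝟭 _) (fun _ ↦ ⟨trivial, trivial⟩)
  have : F.IsEquivalence :=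
    { faithful := ⟨fun h ↦ congr_arg (·.hom) h⟩
      full := ⟨fun f ↦ ⟨f.hom, rfl⟩⟩
      essSurj := ⟨fun X ↦ ⟨X.obj, ⟨Iso.refl _⟩⟩⟩ }
  rw [essentiallySmall_congr F.asEquivalence]
  infer_instance

end Comma

/-! ### Pushouts in diagrams, colimits and full subcategories. -/

section Pushouts

variable {J : Type*} [Category J] {C : Type*} [Category C]

lemma exists_functor_isPushout {F₁ F₂ F₃ : J ⥤ C} (a : F₁ ⟶ F₂) (b : F₁ ⟶ F₃)
    (h : ∀ j, HasPushout (a.app j) (b.app j)) :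
    ∃ (F₄ : J ⥤ C) (c : F₂ ⟶ F₄) (d : F₃ ⟶ F₄),
      ∀ j, IsPushout (a.app j) (b.app j) (c.app j) (d.app j) := by
  have (j : J) : ∃ (W : C) (c : F₂.obj j ⟶ W) (d : F₃.obj j ⟶ W),
      IsPushout (a.app j) (b.app j) c d := ⟨_, _, _, .of_hasPushout _ _⟩
  choose W c d hW using this
  exact ⟨
    { obj := W
      map {j j'} φ := (hW j).desc (F₂.map φ ≫ c j') (F₃.map φ ≫ d j') (by
        simp [← NatTrans.naturality_assoc, (hW j').w])
      map_id j := (hW j).hom_ext (by simp) (by simp)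
      map_comp _ _ := (hW _).hom_ext (by simp) (by simp) },
    { app := c }, { app := d }, hW⟩

/-- A colimit of pushout squares is a pushout square. -/
lemma isPushout_of_isColimit {F₁ F₂ F₃ F₄ : J ⥤ C} {a : F₁ ⟶ F₂} {b : F₁ ⟶ F₃}
    {c : F₂ ⟶ F₄} {d : F₃ ⟶ F₄}
    (h : ∀ j, IsPushout (a.app j) (b.app j) (c.app j) (d.app j))
    {c₁ : Cocone F₁} {c₂ : Cocone F₂} {c₃ : Cocone F₃} {c₄ : Cocone F₄}
    (h₁ : IsColimit c₁) (h₂ : IsColimit c₂) (h₃ : IsColimit c₃) (h₄ : IsColimit c₄)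
    {f : c₁.pt ⟶ c₂.pt} {g : c₁.pt ⟶ c₃.pt} {p : c₂.pt ⟶ c₄.pt} {q : c₃.pt ⟶ c₄.pt}
    (hf : ∀ j, c₁.ι.app j ≫ f = a.app j ≫ c₂.ι.app j)
    (hg : ∀ j, c₁.ι.app j ≫ g = b.app j ≫ c₃.ι.app j)
    (hp : ∀ j, c₂.ι.app j ≫ p = c.app j ≫ c₄.ι.app j)
    (hq : ∀ j, c₃.ι.app j ≫ q = d.app j ≫ c₄.ι.app j) :
    IsPushout f g p q := by
  refine ⟨⟨h₁.hom_ext fun j ↦ ?_⟩, ⟨PushoutCocone.IsColimit.mk _ (fun s ↦ h₄.desc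
    { pt := s.pt
      ι := {
        app j := (h j).desc (c₂.ι.app j ≫ s.inl) (c₃.ι.app j ≫ s.inr) ?_
        naturality j j' φ := ?_ } }) (fun s ↦ ?_) (fun s ↦ ?_) (fun s m hm₁ hm₂ ↦ ?_)⟩⟩
  · rw [reassoc_of% (hf j), reassoc_of% (hg j), hp, hq, (h j).w_assoc]
  · rw [← reassoc_of% (hf j), ← reassoc_of% (hg j), s.condition]
  · dsimp
    rw [Category.comp_id]
    apply (h j).hom_ext
    · rw [← reassoc_of% (c.naturality φ), (h j').inl_desc, (h j).inl_desc, c₂.w_assoc]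
    · rw [← reassoc_of% (d.naturality φ), (h j').inr_desc, (h j).inr_desc, c₃.w_assoc]
  · exact h₂.hom_ext fun j ↦ by rw [reassoc_of% (hp j), h₄.fac, (h j).inl_desc]
  · exact h₃.hom_ext fun j ↦ by rw [reassoc_of% (hq j), h₄.fac, (h j).inr_desc]
  · refine h₄.hom_ext fun j ↦ ?_
    rw [h₄.fac]
    apply (h j).hom_ext
    · rw [(h j).inl_desc, ← hm₁, reassoc_of% (hp j)]
    · rw [(h j).inr_desc, ← hm₂, reassoc_of% (hq j)]

/-- Pushout squares in a full subcategory `P` are pushout squares in the ambient category if the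
categories of objects of `P` over an arbitrary object are filtered. -/
lemma isPushout_map_ι (P : ObjectProperty C)
    [∀ X, IsFiltered (CostructuredArrow P.ι X)] {X₁ X₂ X₃ X₄ : P.FullSubcategory}
    {a : X₁ ⟶ X₂} {b : X₁ ⟶ X₃} {c : X₂ ⟶ X₄} {d : X₃ ⟶ X₄} (h : IsPushout a b c d) :
    IsPushout (P.ι.map a) (P.ι.map b) (P.ι.map c) (P.ι.map d) := by
  have hom_ext {Y : C} {m m' : P.ι.obj X₄ ⟶ Y} (hc : P.ι.map c ≫ m = P.ι.map c ≫ m')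
      (hd : P.ι.map d ≫ m = P.ι.map d ≫ m') : m = m' := by
    let V : CostructuredArrow P.ι Y := .mk m
    let V' : CostructuredArrow P.ι Y := .mk m'
    let l := IsFiltered.leftToMax V V'
    let r := IsFiltered.rightToMax V V'
    let γ : CostructuredArrow.mk (P.ι.map c ≫ m) ⟶ V := CostructuredArrow.homMk c
    let γ' : CostructuredArrow.mk (P.ι.map c ≫ m) ⟶ V' := CostructuredArrow.homMk c hc.symm
    let δ : CostructuredArrow.mk (P.ι.map d ≫ m) ⟶ V := CostructuredArrow.homMk d
    let δ' : CostructuredArrow.mk (P.ι.map d ≫ m) ⟶ V' := CostructuredArrow.homMk d hd.symm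
    -- `l` and `r` have the same source `X₄` in `P`. Coequalizing their restrictions along `c`, then
    -- along `d`, lets the universal property in `P` identify them.
    obtain ⟨W, w, hw⟩ : ∃ (W : _) (w : IsFiltered.max V V' ⟶ W), (γ ≫ l) ≫ w = (γ' ≫ r) ≫ w :=
      ⟨_, _, IsFiltered.coeq_condition _ _⟩
    obtain ⟨W', w', hw'⟩ : ∃ (W' : _) (w' : W ⟶ W'),
        (δ ≫ l ≫ w) ≫ w' = (δ' ≫ r ≫ w) ≫ w' :=
      ⟨_, _, IsFiltered.coeq_condition _ _⟩
    have h₁ : (l ≫ w ≫ w').left = (r ≫ w ≫ w').left := h.hom_ext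
      (by simpa [γ, γ'] using congr(($hw ≫ w').left))
      (by simpa [δ, δ'] using congr(($hw').left))
    calc m = P.ι.map (l ≫ w ≫ w').left ≫ W'.hom := (CostructuredArrow.w (l ≫ w ≫ w')).symm
      _ = P.ι.map (r ≫ w ≫ w').left ≫ W'.hom := by rw [h₁]
      _ = m' := CostructuredArrow.w (r ≫ w ≫ w')
  refine ⟨⟨by simp only [← Functor.map_comp, h.w]⟩,
    ⟨PushoutCocone.isColimitAux' _ fun s ↦ Nonempty.some ?_⟩⟩
  let V₁ : CostructuredArrow P.ι s.pt := .mk (P.ι.map a ≫ s.inl)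
  let V₂ : CostructuredArrow P.ι s.pt := .mk s.inl
  let V₃ : CostructuredArrow P.ι s.pt := .mk s.inr
  let α : V₁ ⟶ V₂ := CostructuredArrow.homMk a
  let β : V₁ ⟶ V₃ := CostructuredArrow.homMk b s.condition.symm
  -- The cocone on `s.pt` factors through one on an object of `P`, where the pushout property
  -- applies.
  obtain ⟨W, p, q, hpq⟩ := IsFiltered.span α β
  have h₁ : a ≫ p.left = b ≫ q.left := congr(($hpq).left)
  have h₂ : P.ι.map c ≫ P.ι.map (h.desc _ _ h₁) ≫ W.hom = s.inl := by
    rw [← P.ι.map_comp_assoc, h.inl_desc]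
    exact CostructuredArrow.w p
  have h₃ : P.ι.map d ≫ P.ι.map (h.desc _ _ h₁) ≫ W.hom = s.inr := by
    rw [← P.ι.map_comp_assoc, h.inr_desc]
    exact CostructuredArrow.w q
  exact ⟨⟨P.ι.map (h.desc _ _ h₁) ≫ W.hom, h₂, h₃,
    fun {m} hm₂ hm₃ ↦ hom_ext (hm₂.trans h₂.symm) (hm₃.trans h₃.symm)⟩⟩

end Pushouts

/-! ### Recognizing pure monomorphisms and very weak cokernel pairs. -/

section Pure

variable {A : Type u} [Category.{v} A] (κ : Cardinal.{w}) [Fact κ.IsRegular]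

/-- A `κ`-filtered colimit of split monomorphisms is `κ`-pure. -/
lemma isPureMono_of_isColimit {J : Type*} [Category J] [EssentiallySmall.{w} J]
    [IsCardinalFiltered J κ] {F G : J ⥤ A} {φ : F ⟶ G} (hφ : ∀ j, IsSplitMono (φ.app j))
    {c : Cocone F} {c' : Cocone G} (hc : IsColimit c) (hc' : IsColimit c') {m : c.pt ⟶ c'.pt}
    (hm : ∀ j, c.ι.app j ≫ m = φ.app j ≫ c'.ι.app j) : IsPureMono κ m := by
  intro S T hS hT t x y h
  have := isFiltered_of_isCardinalFiltered J κ
  obtain ⟨j₁, x', rfl⟩ := IsCardinalPresentable.exists_hom_of_isColimit κ hc x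
  obtain ⟨j₂, y', rfl⟩ := IsCardinalPresentable.exists_hom_of_isColimit κ hc' y
  obtain ⟨j, u, v, huv⟩ := IsCardinalPresentable.exists_eq_of_isColimit κ hc'
    (x' ≫ φ.app j₁) (t ≫ y') (by simpa [hm] using h)
  have := hφ j
  refine ⟨y' ≫ G.map v ≫ retraction (φ.app j) ≫ c.ι.app j, ?_⟩
  simp only [Category.assoc] at huv
  rw [← reassoc_of% huv, ← φ.naturality_assoc, IsSplitMono.id_assoc, c.w]

variable {κ} in
lemma IsPureMono.comp_iso {X Y Z : A} {m : X ⟶ Y} (hm : IsPureMono κ m) (e : Y ≅ Z) :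
    IsPureMono κ (m ≫ e.hom) := fun _ _ hS hT t c d h ↦
  hm hS hT t c (d ≫ e.inv) (by rw [← reassoc_of% h]; simp)

/-- The graphs of `c₁` and `c₂` are split by the first projection. -/
lemma hasVeryWeakCokernelPairs_of_hasBinaryProducts [HasBinaryProducts A] :
    HasVeryWeakCokernelPairs A := fun A B X f c₁ c₂ h ↦
  ⟨B ⨯ X, prod.lift (𝟙 B) c₁, prod.lift (𝟙 B) c₂,
    { comp_eq := by ext <;> simp [h]
      exists_fac := ⟨prod.snd, prod.lift_snd _ _, prod.lift_snd _ _⟩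
      isSplitMono := .mk' ⟨prod.fst, prod.lift_fst _ _⟩ }⟩

end Pure

/-! ### Presentable spans over a given span. -/

section Spans

variable {A : Type u} [Category.{v} A]

/-- The canonical cocone over a diagram of objects of `P` over `X`. -/
def coconeOver {J : Type*} [Category J] (P : ObjectProperty A) {X : A}
    (G : J ⥤ CostructuredArrow P.ι X) : Cocone ((G ⋙ CostructuredArrow.proj P.ι X) ⋙ P.ι) where
  pt := X
  ι := {
    app j := (G.obj j).hom
    naturality _ _ φ := (CostructuredArrow.w (G.map φ)).trans (Category.comp_id _).symm }

/-- If `P` is dense, the canonical cocone over a final diagram of objects of `P` over `X`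
is a colimit cocone. -/
noncomputable def isColimitCoconeOver {J : Type*} [Category J] (P : ObjectProperty A) [P.ι.IsDense]
    {X : A} (G : J ⥤ CostructuredArrow P.ι X) [G.Final] : IsColimit (coconeOver P G) :=
  ((Functor.Final.isColimitWhiskerEquiv G _).symm (P.ι.denseAt X)).ofIsoColimit
    (Cocone.ext (Iso.refl _) fun _ ↦ (Category.comp_id _).trans (Category.id_comp _))

variable (κ : Cardinal.{w}) [Fact κ.IsRegular]
  {X Y Z : A} (m : X ⟶ Y) (f : X ⟶ Z)

/-- The category of spans of `κ`-presentable objects over a given span. -/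
abbrev SpanOver :=
  Comma ((CostructuredArrow.map (S := (isCardinalPresentable A κ).ι) m).prod'
    (CostructuredArrow.map (S := (isCardinalPresentable A κ).ι) f))
    (𝟭 (CostructuredArrow (isCardinalPresentable A κ).ι Y ×
      CostructuredArrow (isCardinalPresentable A κ).ι Z))

/-- The spans of `κ`-presentable objects whose first leg is a split monomorphism. -/
def isSplitSpan : ObjectProperty (SpanOver κ m f) := fun e ↦ IsSplitMono e.hom.1.left

variable [IsCardinalAccessibleCategory A κ]

variable {κ m} in
/-- Every morphism from a morphism `t` between `κ`-presentable objects to a `κ`-pure monomorphism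
factors through a split monomorphism between `κ`-presentable objects. -/
lemma IsPureMono.exists_isSplitMono (hm : IsPureMono κ m) (hA : HasVeryWeakCokernelPairs A)
    {S T : Presentables A κ} (t : S ⟶ T) (c : S.obj ⟶ X) (d : T.obj ⟶ Y)
    (h : c ≫ m = t.hom ≫ d) :
    ∃ (K : Presentables A κ) (e : T.obj ⟶ X) (k₁ k₂ : T ⟶ K) (l : K.obj ⟶ Y),
      IsSplitMono k₁ ∧ t.hom ≫ e = c ∧ k₂.hom ≫ l = d ∧ e ≫ m = k₁.hom ≫ l ∧ t ≫ k₁ = t ≫ k₂ := by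
  obtain ⟨e, rfl⟩ := hm S.property T.property t.hom c d h
  -- The filler `e` need not satisfy `e ≫ m = d`, but both sides agree after `t`.
  obtain ⟨K, k₁, k₂, ⟨hk, ⟨l, hl₁, hl₂⟩, _⟩⟩ := hA t.hom (e ≫ m) d (by simpa using h)
  -- `K` need not be presentable, so `k₁`, `k₂` and their equation are lifted to a stage of a
  -- `κ`-filtered colimit; `k₁` stays split because the stage maps to `K`.
  obtain ⟨J, _, _, ⟨p⟩⟩ :=
    (isCardinalFilteredGenerator_isCardinalPresentable A κ).exists_colimitsOfShape K
  have := isFiltered_of_isCardinalFiltered J κ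
  have hS : IsCardinalPresentable S.obj κ := S.property
  have hT : IsCardinalPresentable T.obj κ := T.property
  obtain ⟨j₁, u₁, hu₁⟩ := IsCardinalPresentable.exists_hom_of_isColimit κ p.isColimit k₁
  obtain ⟨j₂, u₂, hu₂⟩ := IsCardinalPresentable.exists_hom_of_isColimit κ p.isColimit k₂
  obtain ⟨j, a, b, hab⟩ := IsCardinalPresentable.exists_eq_of_isColimit κ p.isColimit
    (t.hom ≫ u₁) (t.hom ≫ u₂) (by simp only [Category.assoc, hu₁, hu₂, hk])
  dsimp at u₁ u₂ hu₁ hu₂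
  refine ⟨⟨p.diag.obj j, p.prop_diag_obj j⟩, e, ObjectProperty.homMk (u₁ ≫ p.diag.map a),
    ObjectProperty.homMk (u₂ ≫ p.diag.map b), p.ι.app j ≫ l, .mk'
    ⟨ObjectProperty.homMk (p.ι.app j ≫ retraction k₁), ?_⟩, rfl, ?_, ?_, ?_⟩
  · ext
    simp [reassoc_of% hu₁]
  · simp [reassoc_of% hu₂, hl₂]
  · simp [reassoc_of% hu₁, hl₁]
  · ext
    simpa using hab

variable {κ m f} in
-- The apex `S` is replaced by `T` itself, sent to `X` by the filler; filteredness over `Z` then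
-- supplies the second leg.
lemma SpanOver.exists_isSplitSpan (hm : IsPureMono κ m) (hA : HasVeryWeakCokernelPairs A)
    (e : SpanOver κ m f) : ∃ e', isSplitSpan κ m f e' ∧ Nonempty (e ⟶ e') := by
  have := isFiltered_of_isCardinalFiltered
    (CostructuredArrow (isCardinalPresentable A κ).ι Z) κ
  obtain ⟨K, r, k₁, k₂, l, hk₁, hr, hk₂, hl, hk⟩ :=
    hm.exists_isSplitMono hA e.hom.1.left e.left.hom e.right.1.hom
      (CostructuredArrow.w e.hom.1).symm
  let T' : CostructuredArrow (isCardinalPresentable A κ).ι X := .mk r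
  let K' : CostructuredArrow (isCardinalPresentable A κ).ι Y := .mk l
  let t : e.left ⟶ T' := CostructuredArrow.homMk e.hom.1.left hr
  let k₁' : (CostructuredArrow.map m).obj T' ⟶ K' := CostructuredArrow.homMk k₁ hl.symm
  let k₂' : e.right.1 ⟶ K' := CostructuredArrow.homMk k₂ hk₂
  obtain ⟨W, p, q, hpq⟩ := IsFiltered.span e.hom.2 ((CostructuredArrow.map f).map t)
  refine ⟨⟨T', (K', W), Prod.mkHom k₁' q⟩, hk₁,
    ⟨{ left := t, right := Prod.mkHom k₂' p, w := Prod.hom_ext ?_ hpq.symm }⟩⟩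
  ext : 1
  exact hk

lemma isCardinalFiltered_spanOver : IsCardinalFiltered (SpanOver κ m f) κ :=
  isCardinalFiltered_comma_id κ _

lemma essentiallySmall_spanOver : EssentiallySmall.{w} (SpanOver κ m f) := by
  have := essentiallySmall_prod.{w} (J := CostructuredArrow (isCardinalPresentable A κ).ι Y)
    (T := CostructuredArrow (isCardinalPresentable A κ).ι Z)
  exact essentiallySmall_comma _ _

variable {κ m} in
lemma IsPureMono.exists_isPushout (hm : IsPureMono κ m) (hA : HasVeryWeakCokernelPairs A)
    (hP : HasPushoutsOfSplitMonos (Presentables A κ)) :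
    ∃ (W : A) (p : Y ⟶ W) (q : Z ⟶ W), IsPushout m f p q ∧ IsPureMono κ q := by
  let P := isCardinalPresentable A κ
  have hPf (V : A) : IsFiltered (CostructuredArrow P.ι V) := isFiltered_of_isCardinalFiltered _ κ
  have := isCardinalFiltered_spanOver κ m f
  have := isFiltered_of_isCardinalFiltered (SpanOver κ m f) κ
  have := essentiallySmall_spanOver κ m f
  let J := (isSplitSpan κ m f).FullSubcategory
  have hcof := SpanOver.exists_isSplitSpan hm hA (f := f)
  have : IsCardinalFiltered J κ := isCardinalFiltered_fullSubcategory κ _ hcof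
  have : ObjectProperty.EssentiallySmall.{w} (isSplitSpan κ m f) := .of_le le_top
  have : EssentiallySmall.{w} J :=
    inferInstanceAs (EssentiallySmall.{w} (isSplitSpan κ m f).FullSubcategory)
  have : (isSplitSpan κ m f).ι.Final :=
    Functor.final_of_exists_of_isFiltered_of_fullyFaithful _ fun e ↦ by
      obtain ⟨e', he', ⟨g⟩⟩ := hcof e
      exact ⟨⟨e', he'⟩, ⟨g⟩⟩
  let G₁ : J ⥤ CostructuredArrow P.ι X := (isSplitSpan κ m f).ι ⋙ Comma.fst _ _
  let G₂ : J ⥤ CostructuredArrow P.ι Y :=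
    (isSplitSpan κ m f).ι ⋙ Comma.snd _ _ ⋙ CategoryTheory.Prod.fst _ _
  let G₃ : J ⥤ CostructuredArrow P.ι Z :=
    (isSplitSpan κ m f).ι ⋙ Comma.snd _ _ ⋙ CategoryTheory.Prod.snd _ _
  let a : G₁ ⋙ CostructuredArrow.proj P.ι X ⟶ G₂ ⋙ CostructuredArrow.proj P.ι Y :=
    { app j := j.obj.hom.1.left
      naturality _ _ φ := congr(($(φ.hom.w).1).left) }
  let b : G₁ ⋙ CostructuredArrow.proj P.ι X ⟶ G₃ ⋙ CostructuredArrow.proj P.ι Z :=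
    { app j := j.obj.hom.2.left
      naturality _ _ φ := congr(($(φ.hom.w).2).left) }
  obtain ⟨F, c, d, h⟩ := exists_functor_isPushout a b fun j ↦ hP _ _ j.property
  have : HasColimitsOfShape J A := by
    have : IsCardinalFiltered (SmallModel.{w} J) κ := .of_equivalence κ (equivSmallModel.{w} J)
    have := HasCardinalFilteredColimits.hasColimitsOfShape (C := A) κ (SmallModel.{w} J)
    exact hasColimitsOfShape_of_equivalence (equivSmallModel.{w} J).symm
  have hF := colimit.isColimit (F ⋙ P.ι)
  let p : Y ⟶ colimit (F ⋙ P.ι) := (isColimitCoconeOver P G₂).map (colimit.cocone _)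
    (Functor.whiskerRight c P.ι)
  let q : Z ⟶ colimit (F ⋙ P.ι) := (isColimitCoconeOver P G₃).map (colimit.cocone _)
    (Functor.whiskerRight d P.ι)
  have hq (j : J) : (coconeOver P G₃).ι.app j ≫ q =
      (Functor.whiskerRight d P.ι).app j ≫ colimit.ι (F ⋙ P.ι) j :=
    IsColimit.ι_map _ _ _ _
  refine ⟨_, p, q, isPushout_of_isColimit (a := Functor.whiskerRight a P.ι)
    (b := Functor.whiskerRight b P.ι) (c := Functor.whiskerRight c P.ι)
    (d := Functor.whiskerRight d P.ι) (fun j ↦ isPushout_map_ι P (h j))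
    (isColimitCoconeOver P G₁) (isColimitCoconeOver P G₂) (isColimitCoconeOver P G₃) hF
    (fun j ↦ (CostructuredArrow.w j.obj.hom.1).symm)
    (fun j ↦ (CostructuredArrow.w j.obj.hom.2).symm)
    (fun j ↦ IsColimit.ι_map _ _ _ _) hq,
    isPureMono_of_isColimit κ (φ := Functor.whiskerRight d P.ι) (fun j ↦ ?_)
      (isColimitCoconeOver P G₃) hF hq⟩
  -- A retraction of `a.app j` and the identity induce a retraction of the opposite pushout leg.
  have : IsSplitMono (a.app j) := j.property
  refine .mk' ⟨P.ι.map ((h j).desc (retraction (a.app j) ≫ b.app j) (𝟙 _) (by simp)), ?_⟩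
  simp [← P.ι.map_comp, -ObjectProperty.ι_map]

end Spans

end PureMono

theorem corollary13p2 {A : Type u} [Category.{v} A] (κ : Cardinal.{w}) [Fact κ.IsRegular]
    [IsCardinalAccessibleCategory A κ] :
    (HasFiniteProducts A → PureMono.HasVeryWeakCokernelPairs A) ∧
    (PureMono.HasVeryWeakCokernelPairs A →
      PureMono.HasPushoutsOfSplitMonos (PureMono.Presentables A κ) →
      ∀ ⦃X Y Z : A⦄ (m : X ⟶ Y) (f : X ⟶ Z), PureMono.IsPureMono κ m →
        HasPushout m f ∧
        ∀ ⦃P : A⦄ (f' : Y ⟶ P) (m' : Z ⟶ P), IsPushout m f f' m' →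
          PureMono.IsPureMono κ m') := by
  refine ⟨fun _ ↦ PureMono.hasVeryWeakCokernelPairs_of_hasBinaryProducts,
    fun hA hP X Y Z m f hm ↦ ?_⟩
  obtain ⟨W, p, q, h, hq⟩ := hm.exists_isPushout f hA hP
  refine ⟨h.hasPushout, fun P f' m' h' ↦ ?_⟩
  have := hq.comp_iso (h.isoIsPushout _ _ h')
  rwa [h.inr_isoIsPushout_hom] at this
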